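/- Let $\{a,b\}^+$ be the free semigroup of nonempty finite words over $\{a,b\}$, let $\mu$ and $\xi$ be its endomorphisms with $\mu(a)=ab$, $\mu(b)=ba$ and $\xi(a)=b$, $\xi(b)=a$, and let $\mathbf t$ be the Prouhet--Thue--Morse sequence, that is, the infinite word having $\mu^n(a)$ as a prefix for every $n\ge 0$. An endomorphism $\varphi$ of $\{a,b\}^+$ is applied to an infinite word $w=a_1a_2a_3\cdots$ over $\{a,b\}$ by $\varphi(w)=\varphi(a_1)\varphi(a_2)\varphi(a_3)\cdots$. A suffix of $w$ is an infinite word $a_ma_{m+1}a_{m+2}\cdots$ with $m\ge 1$. Let $w$ be an infinite word over $\{a,b\}$ and suppose that there is an endomorphism $\varphi$ of $\{a,b\}^+$ such that $\varphi(w)$ is a suffix of either $\mathbf t$ or $\xi(\mathbf t)$. Then $w$ is itself a suffix of either $\mathbf t$ or $\xi(\mathbf t)$. Consequently, call an infinite word $w$ over $\{a,b\}$ an infinite binary pattern of $\mathbf t$ if there is an endomorphism $\varphi$ of $\{a,b\}^+$ such that $\varphi(w)$ is a suffix of $\mathbf t$. Then the infinite binary patterns of $\mathbf t$ are exactly the suffixes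 of $\mathbf t$ and the suffixes of $\xi(\mathbf t)$. -/

import Mathlib

namespace ThueMorse

/-- The two-letter alphabet `{a, b}`. -/
inductive Letter where
  | a : Letter
  | b : Letter
  deriving DecidableEq

/-- The free semigroup `{a,b}⁺` of finite nonempty words. -/
abbrev Word : Type := FreeSemigroup Letter

/-- Infinite words `a₁a₂⋯` over `{a,b}`; the letters are indexed from `0`. -/
abbrev InfWord : Type := ℕ → Letter

/-- Endomorphisms of the semigroup `{a,b}⁺`. -/
abbrev Endo : Type := Word →ₙ* Word

/-- The list of letters of a finite word. -/
def letters (u : Word) : List Letter := u.head :: u.tail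

theorem length_letters (u : Word) : (letters u).length = u.length := rfl

/-- The endomorphism `μ`, with `μ(a) = ab` and `μ(b) = ba`. -/
def mu : Endo := FreeSemigroup.lift fun x => match x with
  | Letter.a => FreeSemigroup.of Letter.a * FreeSemigroup.of Letter.b
  | Letter.b => FreeSemigroup.of Letter.b * FreeSemigroup.of Letter.a

/-- The endomorphism `ξ` exchanging the letters `a` and `b`. -/
def xi : Endo := FreeSemigroup.lift fun x => match x with
  | Letter.a => FreeSemigroup.of Letter.b
  | Letter.b => FreeSemigroup.of Letter.a

/-- `μⁿ(a)`. -/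
def muPow (n : ℕ) : Word := (mu^[n]) (FreeSemigroup.of Letter.a)

theorem length_mu (u : Word) : (mu u).length = 2 * u.length := by
  induction u using FreeSemigroup.recOnMul with
  | ih1 x => cases x <;> rfl
  | ih2 x y hx hy => rw [map_mul, FreeSemigroup.length_mul, FreeSemigroup.length_mul, hx, hy]; ring

theorem length_muPow (n : ℕ) : (letters (muPow n)).length = 2 ^ n := by
  rw [length_letters]
  induction n with
  | zero => rfl
  | succ n ih => rw [muPow, Function.iterate_succ_apply', length_mu, ← muPow, ih]; ring

/-- The Prouhet-Thue-Morse sequence: the infinite word whose prefix of length `2ⁿ` is `μⁿ(a)`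
(see `tm_prefix`). Its letter of index `n` is that of `μⁿ(a)`, which has length `2ⁿ > n`. -/
def tm : InfWord := fun n =>
  (letters (muPow n))[n]'(by rw [length_muPow]; exact Nat.lt_two_pow_self)

/-- The prefix of length `n + 1` of an infinite word. -/
def pref (w : InfWord) (n : ℕ) : Word := ⟨w 0, List.ofFn fun i : Fin n => w (i + 1)⟩

theorem length_le_length_map (φ : Endo) (u : Word) : u.length ≤ (φ u).length := by
  induction u using FreeSemigroup.recOnMul with
  | ih1 x => rw [FreeSemigroup.length_of]; exact Nat.succ_le_succ (Nat.zero_le _)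
  | ih2 x y hx hy =>
    rw [map_mul, FreeSemigroup.length_mul, FreeSemigroup.length_mul]; exact add_le_add hx hy

theorem lt_length_map_pref (φ : Endo) (w : InfWord) (n : ℕ) :
    n < (letters (φ (pref w n))).length := by
  have h := length_le_length_map φ (pref w n)
  have h' : (pref w n).length = n + 1 := by simp [pref, FreeSemigroup.length]
  rw [length_letters]; omega

/-- The infinite word `φ(w) = φ(a₁)φ(a₂)⋯` for `w = a₁a₂⋯`. Its letter of index `n` is that of
its prefix `φ(a₁⋯aₙ₊₁)`, which has length at least `n + 1` (see `image_prefix`). -/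
def image (φ : Endo) (w : InfWord) : InfWord := fun n =>
  (letters (φ (pref w n)))[n]'(lt_length_map_pref φ w n)

/-- `w` is a suffix of `v`: `v = a₀a₁⋯` and `w = aₘaₘ₊₁⋯` for some `m`. These are the infinite
segments of `v`. -/
def IsSuffix (w v : InfWord) : Prop := ∃ m : ℕ, ∀ n : ℕ, w n = v (m + n)

/-- `w` is an infinite binary pattern of `t`: some endomorphism of `{a,b}⁺` maps `w` to an
infinite segment of `t`. -/
def IsInfinitePattern (w : InfWord) : Prop := ∃ φ : Endo, IsSuffix (image φ w) tm

/-- Each `μⁿ(a)` is a prefix of `μⁿ⁺¹(a)`. -/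
theorem muPow_prefix (n : ℕ) : letters (muPow n) <+: letters (muPow (n + 1)) := by
  have hm : ∀ u v : Word, letters (u * v) = letters u ++ letters v := fun u v => rfl
  have hmu : ∀ m : ℕ, ∃ v : Word, muPow (m + 1) = muPow m * v := by
    intro m
    induction m with
    | zero => exact ⟨FreeSemigroup.of Letter.b, rfl⟩
    | succ m ih =>
      obtain ⟨v, hv⟩ := ih
      refine ⟨mu v, ?_⟩
      have e : ∀ k, muPow (k + 1) = mu (muPow k) := fun k => Function.iterate_succ_apply' _ _ _
      rw [e (m + 1), hv, map_mul, ← hv, ← e m, hv]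
  obtain ⟨v, hv⟩ := hmu n
  rw [hv, hm]; exact List.prefix_append _ _

/-- Each `μⁿ(a)` is a prefix of `t`. -/
theorem tm_prefix (n i : ℕ) (h : i < (letters (muPow n)).length) :
    (letters (muPow n))[i] = tm i := by
  have mono : ∀ k l, k ≤ l → letters (muPow k) <+: letters (muPow l) := fun k l hkl =>
    Nat.le_induction (List.prefix_refl _) (fun l _ ih => ih.trans (muPow_prefix l)) l hkl
  rcases le_total n i with hni | hni
  · exact (mono n i hni).getElem h
  · exact ((mono i n hni).getElem _).symm

/-- Each `φ(a₁⋯aₙ₊₁)` is a prefix of `φ(w)`. -/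
theorem image_prefix (φ : Endo) (w : InfWord) (n i : ℕ)
    (h : i < (letters (φ (pref w n))).length) : (letters (φ (pref w n)))[i] = image φ w i := by
  have hs : ∀ k, letters (φ (pref w k)) <+: letters (φ (pref w (k + 1))) := by
    intro k
    have e : pref w (k + 1) = pref w k * FreeSemigroup.of (w (k + 1)) := by
      refine FreeSemigroup.ext rfl ?_
      simp only [pref, FreeSemigroup.tail_mul, List.ofFn_succ_last]
      rfl
    rw [e, map_mul]; exact List.prefix_append _ _
  have mono : ∀ k l, k ≤ l → letters (φ (pref w k)) <+: letters (φ (pref w l)) := fun k l hkl =>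
    Nat.le_induction (List.prefix_refl _) (fun l _ ih => ih.trans (hs l)) l hkl
  rcases le_total n i with hni | hni
  · exact (mono n i hni).getElem h
  · exact ((mono i n hni).getElem _).symm

end ThueMorse

/-!
Double letters of `t = μ(t)` start at odd positions, so a factor that occurs in `t` at positions of
both parities has no double letter: it alternates. Since `t` has no overlap `cvcvc`, alternating
factors have length at most four.

Let `φ(w)` be a suffix of `t`. An overlap in `w` would be mapped to one in `t`, so `w` is
overlap-free. Consecutive double letters of an overlap-free word are at distance two or four, except
perhaps at its beginning, so `w = u μ(v)` with `v` overlap-free. Let `{x, y} = {a, b}`. As `v`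
contains `yx` and `xx`, the word `w` contains `xx` and `xyxy`.
* If `|φ(x)|` is odd and `|φ(y)|` even, `xyxy` and `yxyx` make `φ(xy)` and `φ(yx)` alternate; the
  first says that `φ(x)` and `φ(y)` begin differently, the second that they begin alike.
* If both lengths are odd, `xx` makes `φ(x)` alternate, so it ends with its first letter. If `φ(a)`
  and `φ(b)` began alike, there would be a double letter across every cut between blocks, so all
  cuts would be at even positions. So they begin differently, `φ(abab)` alternates, and both lengths
  are `1`.
* If both lengths are even, keeping every second letter turns `φ(w)` into a suffix of `t` or `ξ(t)`
  cut into blocks of half the length, and one concludes by descent.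
-/

namespace ThueMorse

/-- The exchange of the two letters: the map on letters underlying the endomorphism `xi`. -/
def Letter.swap : Letter → Letter
  | a => b
  | b => a

theorem Letter.swap_involutive : Function.Involutive Letter.swap := by rintro (_ | _) <;> rfl

theorem Letter.ne_iff_eq_swap {x y : Letter} : x ≠ y ↔ x = y.swap := by
  cases x <;> cases y <;> simp [Letter.swap]

theorem Letter.eq_of_ne_of_ne {x y z : Letter} (hxy : x ≠ y) (hyz : y ≠ z) : x = z := by
  rw [Letter.ne_iff_eq_swap] at hxy hyz
  rw [hxy, hyz, Letter.swap_involutive]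

theorem eq_or_eq_swap_of_eq_iff_eq {v w : InfWord} (h : ∀ n k, v n = v k ↔ w n = w k) :
    (∀ n, w n = v n) ∨ ∀ n, w n = (v n).swap := by
  by_cases h0 : w 0 = v 0
  · refine .inl fun n => ?_
    by_cases hn : v n = v 0
    · rw [hn, (h n 0).1 hn, h0]
    · exact Letter.eq_of_ne_of_ne (mt (h n 0).2 hn) (h0 ▸ Ne.symm hn)
  · refine .inr fun n => Letter.ne_iff_eq_swap.1 ?_
    by_cases hn : v n = v 0
    · rwa [hn, (h n 0).1 hn]
    · have hwn : w n = v 0 := Letter.eq_of_ne_of_ne (mt (h n 0).2 hn) h0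
      exact hwn ▸ Ne.symm hn

/-! ### Images of infinite words -/

/-- The length of `φ(a₁⋯aₙ)` for `w = a₁a₂⋯`: the position in `φ(w)` of the block that comes from
the letter of index `n`. -/
def cut (φ : Endo) (w : InfWord) (n : ℕ) : ℕ :=
  ∑ i ∈ Finset.range n, (φ (FreeSemigroup.of (w i))).length

theorem cut_succ (φ : Endo) (w : InfWord) (n : ℕ) :
    cut φ w (n + 1) = cut φ w n + (φ (FreeSemigroup.of (w n))).length :=
  Finset.sum_range_succ _ _

theorem cut_eq_mul {φ : Endo} {l : ℕ} (h : ∀ x, (φ (FreeSemigroup.of x)).length = l) (w : InfWord)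
    (n : ℕ) : cut φ w n = l * n := by
  simp [cut, h, mul_comm]

theorem pref_succ (w : InfWord) (n : ℕ) :
    pref w (n + 1) = pref w n * FreeSemigroup.of (w (n + 1)) := by
  refine FreeSemigroup.ext rfl ?_
  simp only [pref, FreeSemigroup.tail_mul, List.ofFn_succ_last]
  rfl

theorem letters_map_pref_succ (φ : Endo) (w : InfWord) (n : ℕ) :
    letters (φ (pref w (n + 1))) =
      letters (φ (pref w n)) ++ letters (φ (FreeSemigroup.of (w (n + 1)))) := by
  rw [pref_succ, map_mul]
  rfl

theorem length_letters_map_pref (φ : Endo) (w : InfWord) (n : ℕ) :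
    (letters (φ (pref w n))).length = cut φ w (n + 1) := by
  induction n with
  | zero => simp [cut, pref, length_letters, FreeSemigroup.of]
  | succ n ih => rw [letters_map_pref_succ, List.length_append, ih, length_letters, ← cut_succ]

theorem image_cut_add (φ : Endo) (w : InfWord) (n j : ℕ)
    (hj : j < (letters (φ (FreeSemigroup.of (w n)))).length) :
    image φ w (cut φ w n + j) = (letters (φ (FreeSemigroup.of (w n))))[j] := by
  cases n with
  | zero =>
    rw [cut, Finset.sum_range_zero, zero_add]
    exact (image_prefix φ w 0 j hj).symm
  | succ n =>
    rw [← length_letters_map_pref, ← image_prefix φ w (n + 1)]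
    · simp [letters_map_pref_succ]
    · simpa [letters_map_pref_succ] using hj

theorem image_id (w : InfWord) : image (MulHom.id Word) w = w := by
  funext n
  have h := image_cut_add (MulHom.id Word) w n 0 (Nat.succ_pos _)
  rwa [cut_eq_mul (l := 1) fun _ => rfl, one_mul] at h

theorem letters_xi_of (x : Letter) : letters (xi (FreeSemigroup.of x)) = [x.swap] := by
  cases x <;> rfl

theorem image_xi (w : InfWord) : image xi w = Letter.swap ∘ w := by
  funext n
  have h := image_cut_add xi w n 0 (Nat.succ_pos _)
  rw [cut_eq_mul (l := 1) (by rintro (_ | _) <;> rfl), one_mul] at h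
  simpa [letters_xi_of] using h

theorem letters_mu_of (x : Letter) : letters (mu (FreeSemigroup.of x)) = [x, x.swap] := by
  cases x <;> rfl

theorem cut_mu (w : InfWord) (n : ℕ) : cut mu w n = 2 * n :=
  cut_eq_mul (fun x => length_mu (FreeSemigroup.of x)) w n

theorem image_mu_two_mul (w : InfWord) (n : ℕ) : image mu w (2 * n) = w n := by
  have h := image_cut_add mu w n 0 (by simp [letters_mu_of])
  simpa [cut_mu, letters_mu_of] using h

theorem image_mu_two_mul_add_one (w : InfWord) (n : ℕ) :
    image mu w (2 * n + 1) = (w n).swap := by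
  have h := image_cut_add mu w n 1 (by simp [letters_mu_of])
  simpa [cut_mu, letters_mu_of] using h

/-! ### The Thue–Morse word -/

theorem letters_injective : Function.Injective letters := fun _ _ h =>
  FreeSemigroup.ext (List.head_eq_of_cons_eq h) (List.tail_eq_of_cons_eq h)

theorem letters_pref (w : InfWord) (n : ℕ) :
    letters (pref w n) = List.ofFn fun i : Fin (n + 1) => w i := by
  simp [letters, pref, List.ofFn_succ]

theorem pref_tm (n : ℕ) : pref tm (2 ^ n - 1) = muPow n := by
  have hlen : (letters (pref tm (2 ^ n - 1))).length = 2 ^ n := by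
    rw [letters_pref, List.length_ofFn, Nat.sub_add_cancel Nat.one_le_two_pow]
  refine letters_injective (List.ext_getElem (by rw [hlen, length_muPow]) fun i _ hi => ?_)
  simp only [letters_pref, List.getElem_ofFn, tm_prefix n i hi]

theorem image_mu_tm : image mu tm = tm := by
  funext n
  have hmu : mu (pref tm (2 ^ n - 1)) = muPow (n + 1) := by
    rw [pref_tm, muPow, muPow, Function.iterate_succ_apply']
  have hn : n < (letters (muPow (n + 1))).length := by
    rw [length_muPow]
    exact n.lt_succ_self.trans Nat.lt_two_pow_self
  rw [← image_prefix mu tm (2 ^ n - 1) n (by rwa [hmu]), ← tm_prefix (n + 1) n hn]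
  simp only [hmu]

theorem tm_two_mul (n : ℕ) : tm (2 * n) = tm n := by
  rw [← image_mu_two_mul tm n, image_mu_tm]

theorem tm_two_mul_add_one (n : ℕ) : tm (2 * n + 1) = (tm n).swap := by
  rw [← image_mu_two_mul_add_one tm n, image_mu_tm]

theorem tm_succ_ne_of_even {i : ℕ} (hi : Even i) : tm (i + 1) ≠ tm i := by
  obtain ⟨k, rfl⟩ := hi.exists_two_nsmul
  rw [smul_eq_mul, Letter.ne_iff_eq_swap, tm_two_mul_add_one, tm_two_mul]

theorem tm_succ_ne_of_odd_add {i j : ℕ} (hij : Odd (i + j)) (h0 : tm i = tm j)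
    (h1 : tm (i + 1) = tm (j + 1)) : tm (i + 1) ≠ tm i := by
  rcases Nat.even_or_odd i with hi | hi
  · exact tm_succ_ne_of_even hi
  · rw [h0, h1]
    exact tm_succ_ne_of_even ((Nat.odd_add.1 hij).1 hi)

/-- No two consecutive letters of the factor `w m ⋯ w (n - 1)` are equal. -/
def Alternates {α : Type*} (w : ℕ → α) (m n : ℕ) : Prop :=
  ∀ i, m ≤ i → i + 1 < n → w (i + 1) ≠ w i

theorem Alternates.apply_add_eq_iff_even {w : InfWord} {m n k : ℕ} (h : Alternates w m n)
    (hk : m + k < n) : w (m + k) = w m ↔ Even k := by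
  induction k with
  | zero => simp
  | succ k ih =>
    have hne : w (m + k + 1) ≠ w (m + k) := h (m + k) (by omega) hk
    rw [Nat.even_add_one, ← ih (by omega)]
    exact ⟨fun e e' => hne (e.trans e'.symm), Letter.eq_of_ne_of_ne hne⟩

/-- The factor of length `2 * q + 1` of `w` at position `s` is an overlap: it has the form `cvcvc`,
where `c` is a letter and `cv` has length `q`. -/
def IsOverlap {α : Type*} (w : ℕ → α) (s q : ℕ) : Prop :=
  0 < q ∧ ∀ i ≤ q, w (s + i) = w (s + q + i)

/-- No factor of `w` is an overlap `cvcvc`, with `c` a letter and `v` a possibly empty word. -/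
def OverlapFree {α : Type*} (w : ℕ → α) : Prop := ∀ s q, ¬ IsOverlap w s q

theorem not_isOverlap_tm_of_odd {s q : ℕ} (hq : Odd q) : ¬ IsOverlap tm s q := by
  rintro ⟨-, h⟩
  have halt : Alternates tm s (s + q + 1) := by
    intro i hi hiq
    obtain ⟨k, rfl⟩ := Nat.exists_eq_add_of_le hi
    refine tm_succ_ne_of_odd_add (j := s + q + k) ?_ (h k (by omega)) (h (k + 1) (by omega))
    rw [show s + k + (s + q + k) = q + 2 * (s + k) by ring]
    exact hq.add_even (even_two_mul _)
  exact Nat.not_even_iff_odd.2 hq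
    ((halt.apply_add_eq_iff_even (Nat.lt_succ_self _)).1 (h 0 q.zero_le).symm)

theorem IsOverlap.tm_half {s q : ℕ} (h : IsOverlap tm s (2 * q)) : IsOverlap tm (s / 2) q := by
  obtain ⟨hq, h⟩ := h
  refine ⟨by omega, fun i hi => ?_⟩
  have hi2 := h (2 * i) (by omega)
  rcases Nat.even_or_odd' s with ⟨k, rfl | rfl⟩
  · rw [Nat.mul_div_cancel_left k two_pos]
    rwa [← mul_add, ← mul_add, ← mul_add, tm_two_mul, tm_two_mul] at hi2
  · rw [show (2 * k + 1) / 2 = k by omega]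
    rw [show 2 * k + 1 + 2 * i = 2 * (k + i) + 1 by ring,
      show 2 * k + 1 + 2 * q + 2 * i = 2 * (k + q + i) + 1 by ring,
      tm_two_mul_add_one, tm_two_mul_add_one] at hi2
    exact Letter.swap_involutive.injective hi2

theorem overlapFree_tm : OverlapFree tm := by
  intro s q
  induction q using Nat.strong_induction_on generalizing s with
  | _ q ih =>
    intro h
    rcases Nat.even_or_odd' q with ⟨r, rfl | rfl⟩
    · have := h.1
      exact ih r (by omega) (s / 2) h.tm_half
    · exact not_isOverlap_tm_of_odd ⟨r, rfl⟩ h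

/-! ### Parsings -/

/-- The positions `p 0 < p 1 < ⋯` cut a suffix of `v` into blocks; the block of index `n` is
determined by the letter `w n`, and has length `L (w n)`. In other words, that suffix of `v` is the
image of `w` under a substitution. The words substituted for the letters are not part of the data,
so that the notion is invariant under renaming the letters of `v`. -/
structure IsParsing {α β : Type*} (v : ℕ → β) (w : ℕ → α) (L : α → ℕ) (p : ℕ → ℕ) : Prop where
  pos : ∀ x, 0 < L x
  succ : ∀ n, p (n + 1) = p n + L (w n)
  block : ∀ n k, w n = w k → ∀ j < L (w n), v (p n + j) = v (p k + j)

theorem isParsing_image (φ : Endo) (w : InfWord) :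
    IsParsing (image φ w) w (fun x => (φ (FreeSemigroup.of x)).length) (cut φ w) where
  pos _ := Nat.succ_pos _
  succ := cut_succ φ w
  block n k h j hj := by
    rw [image_cut_add φ w n j hj, image_cut_add φ w k j (by rwa [← h])]
    simp only [h]

namespace IsParsing

section

variable {α β : Type*} {v : ℕ → β} {w : ℕ → α} {L : α → ℕ} {p : ℕ → ℕ}

theorem of_shift {m : ℕ} (h : IsParsing (fun n => v (m + n)) w L p) :
    IsParsing v w L (fun n => m + p n) where
  pos := h.pos
  succ n := by rw [h.succ, add_assoc]
  block n k e j hj := by simpa only [add_assoc] using h.block n k e j hj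

theorem of_comp {γ : Type*} {f : β → γ} (hf : f.Injective) (h : IsParsing (f ∘ v) w L p) :
    IsParsing v w L p where
  pos := h.pos
  succ := h.succ
  block n k e j hj := hf (h.block n k e j hj)

theorem strictMono (h : IsParsing v w L p) : StrictMono p :=
  strictMono_nat_of_lt_succ fun n => by
    rw [h.succ]
    exact Nat.lt_add_of_pos_right (h.pos _)

theorem length_factor_eq (h : IsParsing v w L p) {s s' n : ℕ}
    (hw : ∀ i < n, w (s + i) = w (s' + i)) : p (s + n) + p s' = p (s' + n) + p s := by
  induction n with
  | zero => exact add_comm _ _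
  | succ n ih =>
    have hs := h.succ (s + n)
    have hs' := h.succ (s' + n)
    rw [← hw n n.lt_succ_self] at hs'
    have := ih fun i hi => hw i (hi.trans n.lt_succ_self)
    simp only [← add_assoc]
    omega

theorem factor_eq (h : IsParsing v w L p) {s s' n : ℕ} (hw : ∀ i < n, w (s + i) = w (s' + i))
    {j : ℕ} (hj : p s + j < p (s + n)) : v (p s + j) = v (p s' + j) := by
  induction n with
  | zero => simp at hj
  | succ n ih =>
    have hw' : ∀ i < n, w (s + i) = w (s' + i) := fun i hi => hw i (hi.trans n.lt_succ_self)
    rcases lt_or_ge (p s + j) (p (s + n)) with hlt | hge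
    · exact ih hw' hlt
    · obtain ⟨k, hk⟩ := Nat.exists_eq_add_of_le hge
      have hlen := h.length_factor_eq hw'
      rw [← add_assoc, h.succ] at hj
      have hblock := h.block _ _ (hw n n.lt_succ_self) k (by omega)
      rwa [← hk, show p (s' + n) + k = p s' + j by omega] at hblock

theorem overlapFree (h : IsParsing v w L p) (hv : OverlapFree v) : OverlapFree w := by
  rintro s q ⟨hq, ho⟩
  have hlt : p s < p (s + q) := h.strictMono (Nat.lt_add_of_pos_right hq)
  have hlt' : p (s + q) < p (s + (q + 1)) := h.strictMono (by omega)
  refine hv (p s) (p (s + q) - p s) ⟨Nat.sub_pos_of_lt hlt, fun i hi => ?_⟩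
  rw [Nat.add_sub_cancel' hlt.le]
  exact h.factor_eq (n := q + 1) (fun i hi => ho i (Nat.lt_succ_iff.1 hi)) (by omega)

end

end IsParsing

/-! ### Overlap-free binary words -/

namespace OverlapFree

theorem of_shift {α : Type*} {w : ℕ → α} (hw : OverlapFree w) (m : ℕ) :
    OverlapFree fun n => w (m + n) := fun s q ⟨hq, h⟩ =>
  hw (m + s) q ⟨hq, fun i hi => by simpa only [add_assoc] using h i hi⟩

theorem not_cube {α : Type*} {w : ℕ → α} (hw : OverlapFree w) {s : ℕ} (h0 : w s = w (s + 1)) :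
    w (s + 1) ≠ w (s + 2) := fun h1 =>
  hw s 1 ⟨one_pos, fun i hi => by interval_cases i; exacts [h0, h1]⟩

variable {w : InfWord}

theorem exists_succ_eq_between (hw : OverlapFree w) (s : ℕ) :
    ∃ i, s ≤ i ∧ i ≤ s + 3 ∧ w (i + 1) = w i := by
  by_contra! h
  refine hw s 2 ⟨two_pos, fun i hi => ?_⟩
  rw [add_right_comm]
  exact (Letter.eq_of_ne_of_ne (h (s + i + 1) (by omega) (by omega))
    (h (s + i) (by omega) (by omega))).symm

theorem le_add_four_of_alternates (hw : OverlapFree w) {m n : ℕ} (h : Alternates w m n) :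
    n ≤ m + 4 := by
  by_contra! hn
  obtain ⟨i, hi, hi', heq⟩ := hw.exists_succ_eq_between m
  exact h i hi (by omega) heq

theorem eq_succ_add_two_or_add_four (hw : OverlapFree w) {s : ℕ} (h : w (s + 1) = w (s + 2)) :
    w (s + 3) = w (s + 4) ∨ w (s + 5) = w (s + 6) := by
  by_contra! hne
  obtain ⟨h34, h56⟩ := hne
  have h23 : w (s + 2) ≠ w (s + 3) := hw.not_cube h
  have h01 : w s ≠ w (s + 1) := fun h0 => hw.not_cube h0 h
  have h24 : w (s + 2) = w (s + 4) := Letter.eq_of_ne_of_ne h23 h34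
  by_cases h45 : w (s + 4) = w (s + 5)
  · -- `w s ⋯ w (s + 6)` is `yxxyxxy`
    refine hw s 3 ⟨by omega, fun i hi => ?_⟩
    interval_cases i
    · exact Letter.eq_of_ne_of_ne h01 (h ▸ h23)
    · exact h.trans h24
    · exact h24.trans h45
    · exact Letter.eq_of_ne_of_ne h34 (h45 ▸ h56)
  · -- `w (s + 2) ⋯ w (s + 6)` is `xyxyx`
    refine hw (s + 2) 2 ⟨two_pos, fun i hi => ?_⟩
    interval_cases i
    · exact h24
    · exact Letter.eq_of_ne_of_ne h34 h45
    · exact Letter.eq_of_ne_of_ne h45 h56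

theorem exists_forall_succ_ne (hw : OverlapFree w) :
    ∃ m, ∀ n, w (m + 2 * n + 1) ≠ w (m + 2 * n) := by
  obtain ⟨r, hr, -, h⟩ := hw.exists_succ_eq_between 1
  obtain ⟨s, rfl⟩ := Nat.exists_eq_add_of_le' hr
  have double : ∀ n, w (s + 2 * n + 1) = w (s + 2 * n + 2) ∨
      w (s + 2 * n + 3) = w (s + 2 * n + 4) := by
    intro n
    induction n with
    | zero => exact .inl h.symm
    | succ n ih => exact ih.elim hw.eq_succ_add_two_or_add_four .inl
  refine ⟨s + 2, fun n heq => ?_⟩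
  rw [show s + 2 + 2 * n = s + 2 * n + 2 by ring] at heq
  rcases double n with h1 | h3
  · exact hw.not_cube h1 heq.symm
  · exact hw.not_cube heq.symm h3

theorem exists_isSuffix_image_mu (hw : OverlapFree w) :
    ∃ v : InfWord, OverlapFree v ∧ IsSuffix (image mu v) w := by
  obtain ⟨m, hm⟩ := hw.exists_forall_succ_ne
  let v : InfWord := fun n => w (m + 2 * n)
  have hv : image mu v = fun n => w (m + n) := by
    funext n
    rcases Nat.even_or_odd' n with ⟨k, rfl | rfl⟩
    · exact image_mu_two_mul v k
    · exact (image_mu_two_mul_add_one v k).trans (Letter.ne_iff_eq_swap.1 (hm k)).symm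
  refine ⟨v, (isParsing_image mu v).overlapFree ?_, m, congrFun hv⟩
  rw [hv]
  exact hw.of_shift m

theorem exists_apply_eq (hw : OverlapFree w) (x : Letter) : ∃ n, w n = x := by
  by_contra! h
  have hx (n : ℕ) : w n = x.swap := Letter.ne_iff_eq_swap.1 (h n)
  exact hw.not_cube (s := 0) ((hx 0).trans (hx 1).symm) ((hx 1).trans (hx 2).symm)

theorem exists_swap_self (hw : OverlapFree w) (x : Letter) :
    ∃ s, w s = x.swap ∧ w (s + 1) = x := by
  obtain ⟨r, hr⟩ := hw.exists_apply_eq x.swap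
  by_cases h : w (r + 1) = w r
  · have hne : w (r + 2) ≠ w (r + 1) := (hw.not_cube h.symm).symm
    rw [Letter.ne_iff_eq_swap, h, hr, Letter.swap_involutive] at hne
    exact ⟨r + 1, h.trans hr, hne⟩
  · rw [← ne_eq, Letter.ne_iff_eq_swap, hr, Letter.swap_involutive] at h
    exact ⟨r, hr, h⟩

theorem exists_self_self (hw : OverlapFree w) (x : Letter) : ∃ s, w s = x ∧ w (s + 1) = x := by
  obtain ⟨v, hv, m, hm⟩ := hw.exists_isSuffix_image_mu
  obtain ⟨s, h0, h1⟩ := hv.exists_swap_self x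
  refine ⟨m + (2 * s + 1), ?_, ?_⟩
  · rw [← hm, image_mu_two_mul_add_one, h0, Letter.swap_involutive]
  · rw [add_assoc, ← hm, add_assoc, ← mul_add_one, image_mu_two_mul, h1]

theorem exists_self_swap_self_swap (hw : OverlapFree w) (x : Letter) :
    ∃ s, w s = x ∧ w (s + 1) = x.swap ∧ w (s + 2) = x ∧ w (s + 3) = x.swap := by
  obtain ⟨v, hv, m, hm⟩ := hw.exists_isSuffix_image_mu
  obtain ⟨s, h0, h1⟩ := hv.exists_self_self x
  refine ⟨m + 2 * s, ?_, ?_, ?_, ?_⟩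
  · rw [← hm, image_mu_two_mul, h0]
  · rw [add_assoc, ← hm, image_mu_two_mul_add_one, h0]
  · rw [add_assoc, ← hm, ← mul_add_one, image_mu_two_mul, h1]
  · rw [add_assoc, ← hm, show 2 * s + 3 = 2 * (s + 1) + 1 by ring, image_mu_two_mul_add_one, h1]

end OverlapFree

/-! ### Parsings of the Thue–Morse word -/

namespace IsParsing

variable {w : InfWord} {L : Letter → ℕ} {p : ℕ → ℕ}

theorem alternates_of_odd_add (h : IsParsing tm w L p) {s s' n : ℕ}
    (hw : ∀ i < n, w (s + i) = w (s' + i)) (hodd : Odd (p s + p s')) :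
    Alternates tm (p s) (p (s + n)) := by
  intro i hi hin
  obtain ⟨j, rfl⟩ := Nat.exists_eq_add_of_le hi
  refine tm_succ_ne_of_odd_add (j := p s' + j) ?_ (h.factor_eq hw (by omega))
    (h.factor_eq hw (j := j + 1) hin)
  rw [add_add_add_comm]
  exact hodd.add_even (Even.add_self j)

theorem exists_alternates_self_swap (h : IsParsing tm w L p) {x : Letter}
    (hodd : Odd (L x + L x.swap)) :
    ∃ s, w s = x ∧ w (s + 1) = x.swap ∧ Alternates tm (p s) (p (s + 2)) := by
  obtain ⟨s, h0, h1, h2, h3⟩ := (h.overlapFree overlapFree_tm).exists_self_swap_self_swap x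
  refine ⟨s, h0, h1, h.alternates_of_odd_add (s' := s + 2) (fun i hi => ?_) ?_⟩
  · interval_cases i
    · exact h0.trans h2.symm
    · exact h1.trans h3.symm
  · rw [h.succ, h.succ, h0, h1, add_assoc (p s), ← add_assoc (p s)]
    exact (Even.add_self _).add_odd hodd

theorem odd_swap (h : IsParsing tm w L p) {x : Letter} (hx : Odd (L x)) : Odd (L x.swap) := by
  by_contra hy
  rw [Nat.not_odd_iff_even] at hy
  obtain ⟨s, s0, s1, hs⟩ := h.exists_alternates_self_swap (hx.add_even hy)
  obtain ⟨r, r0, r1, hr⟩ := h.exists_alternates_self_swap (x := x.swap)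
    (by rw [Letter.swap_involutive]; exact hy.add_odd hx)
  rw [Letter.swap_involutive] at r1
  have hne : tm (p (s + 1)) ≠ tm (p s) := by
    have hlt : p (s + 1) < p (s + 2) := h.strictMono (by omega)
    rw [h.succ, s0] at hlt ⊢
    rwa [ne_eq, hs.apply_add_eq_iff_even hlt, Nat.not_even_iff_odd]
  have heq : tm (p (r + 1)) = tm (p r) := by
    have hlt : p (r + 1) < p (r + 2) := h.strictMono (by omega)
    rw [h.succ, r0] at hlt ⊢
    rwa [hr.apply_add_eq_iff_even hlt]
  have hy0 : tm (p (s + 1)) = tm (p r) := h.block _ _ (s1.trans r0.symm) 0 (h.pos _)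
  have hx0 : tm (p (r + 1)) = tm (p s) := h.block _ _ (r1.trans s0.symm) 0 (h.pos _)
  exact hne (hy0.trans (heq.symm.trans hx0))

theorem alternates_block (h : IsParsing tm w L p) (hodd : ∀ x, Odd (L x)) (n : ℕ) :
    Alternates tm (p n) (p (n + 1)) := by
  obtain ⟨s, h0, h1⟩ := (h.overlapFree overlapFree_tm).exists_self_self (w n)
  have of_occurrence {k : ℕ} (hk : w k = w n) (hnk : Odd (p n + p k)) :
      Alternates tm (p n) (p (n + 1)) :=
    h.alternates_of_odd_add (s' := k) (fun i hi => by rw [Nat.lt_one_iff.1 hi]; exact hk.symm) hnk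
  rcases Nat.even_or_odd (p n + p s) with he | ho
  · refine of_occurrence h1 ?_
    rw [h.succ, ← add_assoc]
    exact he.add_odd (hodd _)
  · exact of_occurrence h0 ho

theorem tm_block_last (h : IsParsing tm w L p) (hodd : ∀ x, Odd (L x)) {n i : ℕ}
    (hi : p (n + 1) = i + 1) : tm i = tm (p n) := by
  obtain ⟨k, hk⟩ := hodd (w n)
  have hsucc := h.succ n
  obtain rfl : i = p n + 2 * k := by omega
  exact ((h.alternates_block hodd n).apply_add_eq_iff_even (by omega)).2 (even_two_mul k)

theorem tm_block_head_eq_iff (h : IsParsing tm w L p) (hodd : ∀ x, Odd (L x)) (n k : ℕ) :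
    tm (p n) = tm (p k) ↔ w n = w k := by
  refine ⟨fun heq => ?_, fun hw => h.block n k hw 0 (h.pos _)⟩
  by_contra hne
  have hconst (i : ℕ) : tm (p i) = tm (p n) := by
    by_cases hi : w i = w n
    · exact h.block i n hi 0 (h.pos _)
    · exact (h.block i k (Letter.eq_of_ne_of_ne hi hne) 0 (h.pos _)).trans heq.symm
  have hcut (i : ℕ) : Even (p (i + 1)) := by
    obtain ⟨j, hj⟩ := Nat.exists_eq_add_one_of_ne_zero (h.strictMono i.lt_succ_self).ne_bot
    have hdouble : tm (j + 1) = tm j := by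
      rw [h.tm_block_last hodd hj, ← hj, hconst, hconst i]
    rw [hj, Nat.even_add_one]
    exact fun he => tm_succ_ne_of_even he hdouble
  have := hcut 1
  rw [h.succ] at this
  exact Nat.not_even_iff_odd.2 ((hcut 0).add_odd (hodd _)) this

theorem alternates_of_forall_succ_ne (h : IsParsing tm w L p) (hodd : ∀ x, Odd (L x)) {s n : ℕ}
    (hne : ∀ i < n, w (s + i + 1) ≠ w (s + i)) :
    Alternates tm (p s) (p (s + n + 1)) := by
  induction n with
  | zero => exact h.alternates_block hodd s
  | succ n ih =>
    intro i hi hin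
    rcases lt_trichotomy (p (s + n + 1)) (i + 1) with hlt | heq | hgt
    · exact h.alternates_block hodd (s + n + 1) i (by omega) hin
    · rw [← heq, h.tm_block_last hodd heq, ne_eq, h.tm_block_head_eq_iff hodd]
      exact hne n n.lt_succ_self
    · exact ih (fun i hi => hne i (hi.trans n.lt_succ_self)) i hi hgt

theorem length_eq_one (h : IsParsing tm w L p) (hodd : ∀ x, Odd (L x)) (x : Letter) : L x = 1 := by
  obtain ⟨s, h0, h1, h2, h3⟩ := (h.overlapFree overlapFree_tm).exists_self_swap_self_swap x
  have halt : Alternates tm (p s) (p (s + 3 + 1)) := by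
    refine h.alternates_of_forall_succ_ne hodd fun i hi => ?_
    interval_cases i <;> simp only [add_zero, add_assoc, Nat.reduceAdd, h0, h1, h2, h3] <;>
      simp only [Letter.ne_iff_eq_swap, Letter.swap_involutive x]
  have hle := overlapFree_tm.le_add_four_of_alternates halt
  have hmono : 3 + p (s + 1) ≤ p (3 + (s + 1)) := h.strictMono.add_le_nat 3 (s + 1)
  rw [show 3 + (s + 1) = s + 3 + 1 by ring, h.succ s, h0] at hmono
  have := h.pos x
  omega

theorem isSuffix_of_odd (h : IsParsing tm w L p) (hodd : ∀ x, Odd (L x)) :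
    IsSuffix w tm ∨ IsSuffix w (image xi tm) := by
  have hp (n : ℕ) : p n = p 0 + n := by
    induction n with
    | zero => rfl
    | succ n ih => rw [h.succ, h.length_eq_one hodd, ih, add_assoc]
  have hiff (n k : ℕ) : tm (p 0 + n) = tm (p 0 + k) ↔ w n = w k := by
    rw [← hp, ← hp, h.tm_block_head_eq_iff hodd]
  rw [image_xi]
  exact (eq_or_eq_swap_of_eq_iff_eq hiff).imp (⟨p 0, ·⟩) (⟨p 0, ·⟩)

theorem half (h : IsParsing tm w L p) (heven : ∀ x, Even (L x)) :
    IsParsing tm w (fun x => L x / 2) (fun n => p n / 2) := by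
  have hL (x : Letter) : 2 * (L x / 2) = L x := Nat.two_mul_div_two_of_even (heven x)
  have hmod (n : ℕ) : p n % 2 = p 0 % 2 := by
    induction n with
    | zero => rfl
    | succ n ih => rw [h.succ, ← hL, Nat.add_mul_mod_self_left, ih]
  refine ⟨fun x => ?_, fun n => ?_, fun n k hw j hj => ?_⟩
  · have := h.pos x
    have := hL x
    omega
  · rw [h.succ, ← hL, Nat.add_mul_div_left _ _ two_pos, hL]
  · have hblock := h.block n k hw (2 * j) (by omega)
    rw [← Nat.mod_add_div (p n) 2, ← Nat.mod_add_div (p k) 2, hmod n, hmod k, add_assoc, add_assoc,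
      ← mul_add, ← mul_add] at hblock
    rcases Nat.mod_two_eq_zero_or_one (p 0) with h0 | h1
    · rwa [h0, zero_add, zero_add, tm_two_mul, tm_two_mul] at hblock
    · rw [h1, add_comm 1, add_comm 1, tm_two_mul_add_one, tm_two_mul_add_one] at hblock
      exact Letter.swap_involutive.injective hblock

theorem isSuffix (h : IsParsing tm w L p) : IsSuffix w tm ∨ IsSuffix w (image xi tm) := by
  induction hN : L Letter.a using Nat.strong_induction_on generalizing L p with
  | _ N ih =>
    rcases Nat.even_or_odd (L Letter.a) with ha | ha
    · have hb : Even (L Letter.b) := by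
        rw [← Nat.not_odd_iff_even] at ha ⊢
        exact mt h.odd_swap ha
      have hpos := h.pos Letter.a
      exact ih _ (by omega) (h.half (by rintro (_ | _) <;> assumption)) rfl
    · have hb : Odd (L Letter.b) := h.odd_swap ha
      exact h.isSuffix_of_odd (by rintro (_ | _) <;> assumption)

end IsParsing

theorem isSuffix_of_isSuffix_image {φ : Endo} {w : InfWord}
    (h : IsSuffix (image φ w) tm ∨ IsSuffix (image φ w) (image xi tm)) :
    IsSuffix w tm ∨ IsSuffix w (image xi tm) := by
  have hpars := isParsing_image φ w
  rcases h with ⟨m, hm⟩ | ⟨m, hm⟩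
  · rw [funext hm] at hpars
    exact hpars.of_shift.isSuffix
  · rw [funext hm, image_xi] at hpars
    exact (hpars.of_shift.of_comp Letter.swap_involutive.injective).isSuffix

theorem isSuffix_image_xi_tm_iff {w : InfWord} :
    IsSuffix w (image xi tm) ↔ IsSuffix (image xi w) tm := by
  simp only [IsSuffix, image_xi, Function.comp_apply, Letter.swap_involutive.eq_iff]

end ThueMorse

theorem mainTheorem4 :
    (∀ w : ThueMorse.InfWord,
      (∃ φ : ThueMorse.Endo,
        ThueMorse.IsSuffix (ThueMorse.image φ w) ThueMorse.tm ∨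
        ThueMorse.IsSuffix (ThueMorse.image φ w) (ThueMorse.image ThueMorse.xi ThueMorse.tm)) →
      ThueMorse.IsSuffix w ThueMorse.tm ∨
        ThueMorse.IsSuffix w (ThueMorse.image ThueMorse.xi ThueMorse.tm)) ∧
    (∀ w : ThueMorse.InfWord,
      ThueMorse.IsInfinitePattern w ↔
        ThueMorse.IsSuffix w ThueMorse.tm ∨
          ThueMorse.IsSuffix w (ThueMorse.image ThueMorse.xi ThueMorse.tm)) := by
  refine ⟨fun w ⟨_, hφ⟩ => ThueMorse.isSuffix_of_isSuffix_image hφ, fun w =>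
    ⟨fun ⟨_, hφ⟩ => ThueMorse.isSuffix_of_isSuffix_image (.inl hφ), ?_⟩⟩
  rintro (hw | hw)
  · exact ⟨MulHom.id ThueMorse.Word, by rwa [ThueMorse.image_id]⟩
  · exact ⟨ThueMorse.xi, ThueMorse.isSuffix_image_xi_tm_iff.1 hw⟩
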